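/- Let $P$ be a partially ordered set and let $r\ge 1$. Let $P_r$ be the set of all $r$-multichains $p_1\le p_2\le\cdots\le p_r$ in $P$, partially ordered componentwise: $(p_1\le\cdots\le p_r)\sqsubseteq(q_1\le\cdots\le q_r)$ if and only if $p_i\le q_i$ for all $i=1,\dots,r$. For a partially ordered set $Q$ let $\Delta(Q)$ denote its order complex, the abstract simplicial complex on the vertex set $Q$ whose faces are the finite chains of $Q$. Then the order complex of $(P_r,\sqsubseteq)$ is homotopy equivalent to the order complex $\Delta(P)$ of $P$, that is, their geometric realizations (with the weak topology) are homotopy equivalent. -/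

import Mathlib

noncomputable section

/-- The geometric realization of an abstract simplicial complex `K`, as a set: barycentric
coordinates on the vertices, that is, finitely supported non-negative functions on the vertex set
with sum `1` whose support is a face of `K`. -/
@[ext]
structure AbstractSimplicialComplex.Realization {V : Type*} (K : AbstractSimplicialComplex V) where
  /-- the barycentric coordinates of the point -/
  weight : V →₀ ℝ
  nonneg : ∀ v, 0 ≤ weight v
  support_mem : weight.support ∈ K.faces
  sum_eq_one : ∑ v ∈ weight.support, weight v = 1

namespace AbstractSimplicialComplex.Realization

variable {V : Type*} {K : AbstractSimplicialComplex V}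

/-- The closed geometric simplex spanned by the finite vertex set `s`. -/
def closedSimplex (K : AbstractSimplicialComplex V) (s : Finset V) : Set K.Realization :=
  {x | x.weight.support ⊆ s}

/-- The Euclidean topology on the closed simplex spanned by `s`, i.e. the one that it inherits
from `ℝ ^ s` through its barycentric coordinates. -/
@[reducible]
def simplexTopology (K : AbstractSimplicialComplex V) (s : Finset V) :
    TopologicalSpace (closedSimplex K s) :=
  TopologicalSpace.induced (fun x (v : s) => x.1.weight v) inferInstance

/-- The (weak) topology of the geometric realization: the finest topology for which the inclusion
of every closed simplex, with its Euclidean topology, is continuous. -/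
instance : TopologicalSpace K.Realization :=
  ⨆ s : {s : Finset V // s ∈ K.faces},
    TopologicalSpace.coinduced (Subtype.val : closedSimplex K s.1 → K.Realization)
      (simplexTopology K s.1)

end AbstractSimplicialComplex.Realization

/-- The order complex of a poset: the simplicial complex on its elements whose faces are the
(nonempty) finite chains. -/
def orderComplex (Q : Type*) [PartialOrder Q] : AbstractSimplicialComplex Q where
  faces := {s | s.Nonempty ∧ IsChain (· ≤ ·) (s : Set Q)}
  isRelLowerSet_faces := fun _ hs =>
    ⟨hs.1, fun _ hts ht => ⟨ht, hs.2.mono (Finset.coe_subset.2 hts)⟩⟩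
  singleton_mem v := ⟨Finset.singleton_nonempty v, by simp⟩

/-- The `r`-multichains `p₁ ≤ ⋯ ≤ pᵣ` of a poset `P`, i.e. the monotone maps from `Fin r` to `P`.
Mathlib's order on monotone maps is the componentwise order, see `Multichain.le_iff`. -/
abbrev Multichain (P : Type*) [PartialOrder P] (r : ℕ) : Type _ := Fin r →o P

theorem Multichain.le_iff {P : Type*} [PartialOrder P] {r : ℕ} (p q : Multichain P r) :
    p ≤ q ↔ ∀ i, p i ≤ q i :=
  Iff.rfl

end

/-! Taking the first entry and forming constant multichains are monotone maps between `Multichain P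
r` and `P`. One composite is the identity, the other lies below the identity, so it suffices that
monotone maps `f ≤ g` induce homotopic maps (`realizationMap_homotopic`). Straight-line
interpolation may leave the complex: for `y < z`, `f z` and `g y` need not be comparable. Instead
the mass of a point is stacked along its chain and cut at level `1 - t`; the lower part is pushed by
`f`, the upper part by `g`. For `y` below the cut and `z` above it, `f y ≤ g y ≤ g z`, so the
support stays a chain. -/

namespace AbstractSimplicialComplex.Realization

/-! ### Continuity for the weak topology -/

variable {V : Type*} {K : AbstractSimplicialComplex V}

theorem continuous_dom_iff {Y : Type*} [TopologicalSpace Y] {F : K.Realization → Y} :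
    Continuous F ↔ ∀ s ∈ K.faces,
      @Continuous _ _ (simplexTopology K s) _ (fun x : closedSimplex K s => F x.1) := by
  refine continuous_iSup_dom.trans ⟨fun h s hs => ?_, fun h s => ?_⟩
  · exact continuous_coinduced_dom.1 (h ⟨s, hs⟩)
  · exact continuous_coinduced_dom.2 (h s.1 s.2)

/-- A map whose values have their supports in one fixed face is continuous if its barycentric
coordinates are. -/
theorem continuous_of_support_subset_face {X : Type*} [TopologicalSpace X]
    {F : X → K.Realization} {s : Finset V} (hs : s ∈ K.faces)
    (hF : ∀ x, (F x).weight.support ⊆ s) (hc : ∀ v, Continuous fun x => (F x).weight v) :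
    Continuous F := by
  have h := continuous_dom_iff.1 (continuous_id (X := K.Realization)) s hs
  have hG : @Continuous X (closedSimplex K s) _ (simplexTopology K s) (fun x => ⟨F x, hF x⟩) :=
    continuous_induced_rng.2 (continuous_pi fun v => hc v)
  exact @Continuous.comp _ _ _ _ (simplexTopology K s) _ _ _ h hG

/-- A map whose values have their supports in one fixed finite set is continuous if its barycentric
coordinates are. -/
theorem continuous_of_support_subset {X : Type*} [TopologicalSpace X]
    {F : X → K.Realization} (T : Finset V)
    (hF : ∀ x, (F x).weight.support ⊆ T) (hc : ∀ v, Continuous fun x => (F x).weight v) :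
    Continuous F := by
  -- `T` need not be a face; the finitely many faces inside it give a finite closed cover of `X`.
  let C : {s // s ∈ T.powerset ∧ s ∈ K.faces} → Set X := fun s => {x | (F x).weight.support ⊆ s.1}
  have : Finite {s // s ∈ T.powerset ∧ s ∈ K.faces} :=
    (T.powerset.finite_toSet.subset fun _ h => h.1).to_subtype
  refine (locallyFinite_of_finite C).continuous ?_ (fun s => ?_) (fun s => ?_)
  · exact Set.iUnion_eq_univ_iff.2 fun x =>
      ⟨⟨_, Finset.mem_powerset.2 (hF x), (F x).support_mem⟩, fun _ h => h⟩
  · have : C s = ⋂ v, ⋂ _ : v ∉ s.1, {x | (F x).weight v = 0} := by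
      ext x
      simp only [C, Set.mem_ofPred_eq, Set.mem_iInter, Finset.subset_iff, Finsupp.mem_support_iff]
      exact forall_congr' fun v => not_imp_comm
    rw [this]
    exact isClosed_iInter fun v => isClosed_iInter fun _ => isClosed_eq (hc v) continuous_const
  · rw [continuousOn_iff_continuous_domRestrict]
    exact continuous_of_support_subset_face s.2.2 (fun x => x.2)
      fun v => (hc v).comp continuous_subtype_val

theorem continuous_weight (v : V) : Continuous fun x : K.Realization => x.weight v := by
  refine continuous_dom_iff.2 fun s _ => ?_
  by_cases hv : v ∈ s
  · exact @Continuous.comp _ _ _ (simplexTopology K s) _ _ _ _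
      (continuous_apply (⟨v, hv⟩ : s)) continuous_induced_dom
  · have : (fun x : closedSimplex K s => x.1.weight v) = fun _ => 0 :=
      funext fun x => Finsupp.notMem_support_iff.1 fun h => hv (x.2 h)
    rw [this]
    exact @continuous_const _ _ (simplexTopology K s) _ _

end AbstractSimplicialComplex.Realization

theorem Finsupp.mapDomain_apply_of_support_subset {α β M : Type*} [AddCommMonoid M] [DecidableEq β]
    (f : α → β) {a : α →₀ M} {s : Finset α} (hs : a.support ⊆ s) (b : β) :
    a.mapDomain f b = ∑ x ∈ s, if f x = b then a x else 0 := by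
  rw [Finsupp.mapDomain, Finsupp.sum_of_support_subset _ hs _ (by simp), Finsupp.finsetSum_apply]
  simp [Finsupp.single_apply]

theorem Finsupp.mapDomain_nonneg_apply {α β : Type*} (f : α → β) {a : α →₀ ℝ}
    (ha : ∀ x, 0 ≤ a x) (b : β) : 0 ≤ a.mapDomain f b := by
  classical
  rw [Finsupp.mapDomain_apply_of_support_subset f subset_rfl]
  exact Finset.sum_nonneg fun x _ => by split_ifs <;> simp [ha]

/-! ### Cutting a mass function at a level -/

noncomputable section

open Classical in
/-- The part of the mass function `w` which lies below the level `c`, when the mass is stacked up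
along the order of `Q`. -/
def lowerMass {Q : Type*} [PartialOrder Q] (w : Q →₀ ℝ) (c : ℝ) : Q →₀ ℝ :=
  Finsupp.onFinset w.support
    (fun x => if x ∈ w.support then min (w x) (max 0 (c - ∑ y ∈ w.support with y < x, w y)) else 0)
    (fun x hx => by by_contra h; simp [h] at hx)

namespace lowerMass

variable {Q : Type*} [PartialOrder Q] {w : Q →₀ ℝ} {c : ℝ}

theorem support_subset : (lowerMass w c).support ⊆ w.support :=
  Finsupp.support_onFinset_subset

-- Replacing the varying support by a fixed finite `s` makes the formula visibly continuous in the
-- weights and in `c`.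
open Classical in
theorem apply_eq {s : Finset Q} (hs : w.support ⊆ s) (x : Q) :
    lowerMass w c x = min (w x) (max 0 (c - ∑ y ∈ s with y < x, w y)) := by
  have hsum : ∑ y ∈ w.support with y < x, w y = ∑ y ∈ s with y < x, w y :=
    Finset.sum_subset (Finset.filter_subset_filter _ hs) fun y hy hy' => by
      simp only [Finset.mem_filter] at hy hy'
      exact Finsupp.notMem_support_iff.1 fun h => hy' ⟨h, hy.2⟩
  rw [lowerMass, Finsupp.onFinset_apply, hsum]
  split_ifs with h
  · rfl
  · rw [Finsupp.notMem_support_iff.1 h, min_eq_left (le_max_left _ _)]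

theorem nonneg (hw : ∀ x, 0 ≤ w x) (x : Q) : 0 ≤ lowerMass w c x := by
  rw [apply_eq subset_rfl]
  exact le_min (hw x) (le_max_left _ _)

theorem le (x : Q) : lowerMass w c x ≤ w x := by
  rw [apply_eq subset_rfl]
  exact min_le_left _ _

theorem eq_zero (hw : ∀ x, 0 ≤ w x) (hc : c ≤ 0) : lowerMass w c = 0 := by
  classical
  ext x
  rw [apply_eq subset_rfl, max_eq_left, min_eq_right (hw x), Finsupp.zero_apply]
  have := Finset.sum_nonneg fun y (_ : y ∈ w.support.filter (· < x)) => hw y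
  linarith

theorem eq_self (hw : ∀ x, 0 ≤ w x) (hc : ∑ x ∈ w.support, w x ≤ c) : lowerMass w c = w := by
  classical
  ext x
  rw [apply_eq (Finset.subset_insert x w.support)]
  refine min_eq_left (le_max_of_le_right ?_)
  have h1 : w x + ∑ y ∈ insert x w.support with y < x, w y ≤ ∑ y ∈ insert x w.support, w y := by
    rw [← Finset.sum_insert (by simp)]
    refine Finset.sum_le_sum_of_subset_of_nonneg ?_ fun y _ _ => hw y
    exact Finset.insert_subset (Finset.mem_insert_self _ _) (Finset.filter_subset _ _)
  have h2 : ∑ y ∈ insert x w.support, w y = ∑ y ∈ w.support, w y :=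
    Finset.sum_insert_of_eq_zero_if_notMem Finsupp.notMem_support_iff.1
  linarith

/-- The points that carry mass below the level lie below those that carry mass above it. -/
theorem le_of_mem_support (hw : ∀ x, 0 ≤ w x) (hch : IsChain (· ≤ ·) (w.support : Set Q)) {x z : Q}
    (hx : x ∈ (lowerMass w c).support) (hz : z ∈ (w - lowerMass w c).support) : x ≤ z := by
  classical
  have hxw : x ∈ w.support := support_subset hx
  have hzw : z ∈ w.support := by
    by_contra h
    rw [Finsupp.mem_support_iff, Finsupp.sub_apply, Finsupp.notMem_support_iff.1 h,
      Finsupp.notMem_support_iff.1 fun h' => h (support_subset h'), sub_zero] at hz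
    exact hz rfl
  -- If `z < x`, the mass strictly below `x` is less than `c`, yet it includes all mass up to and
  -- including `z`, which exceeds `c`.
  by_contra hxz
  have hzx : z < x := ((hch.total hxw hzw).resolve_left hxz).lt_of_not_ge hxz
  have h1 : 0 < lowerMass w c x := (nonneg hw x).lt_of_ne' (Finsupp.mem_support_iff.1 hx)
  have h2 : lowerMass w c z < w z :=
    (le z).lt_of_ne fun h => Finsupp.mem_support_iff.1 hz (by simp [h])
  rw [apply_eq subset_rfl] at h1 h2
  have h3 := (lt_min_iff.1 h1).2
  rw [lt_max_iff, or_iff_right (lt_irrefl _)] at h3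
  have h4 : max 0 (c - ∑ y ∈ w.support with y < z, w y) < w z := by
    by_contra h
    rw [min_eq_left (not_lt.1 h)] at h2
    exact lt_irrefl _ h2
  have h5 := (max_lt_iff.1 h4).2
  have h6 : w z + ∑ y ∈ w.support with y < z, w y ≤ ∑ y ∈ w.support with y < x, w y := by
    rw [← Finset.sum_insert (by simp)]
    refine Finset.sum_le_sum_of_subset_of_nonneg ?_ fun y _ _ => hw y
    refine Finset.insert_subset (by simp [hzx, Finsupp.mem_support_iff.1 hzw]) fun y hy => ?_
    rw [Finset.mem_filter] at hy ⊢
    exact ⟨hy.1, hy.2.trans hzx⟩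
  linarith

end lowerMass

/-! ### The prism homotopy -/

namespace orderComplex

open AbstractSimplicialComplex AbstractSimplicialComplex.Realization

variable {Q R S : Type*} [PartialOrder Q] [PartialOrder R] [PartialOrder S]

theorem sum_prismWeight {T : Type*} (f g : Q → T) (c : ℝ) (x : (orderComplex Q).Realization) :
    ∑ v ∈ ((lowerMass x.weight c).mapDomain f +
      (x.weight - lowerMass x.weight c).mapDomain g).support,
      ((lowerMass x.weight c).mapDomain f +
        (x.weight - lowerMass x.weight c).mapDomain g) v = 1 := by
  have key : ∀ (h : Q → T) (a : Q →₀ ℝ),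
      ((a.mapDomain h).sum fun _ m => m) = a.sum fun _ m => m := fun h a =>
    Finsupp.sum_mapDomain_index (fun _ => rfl) fun _ _ _ => rfl
  change Finsupp.sum (_ + _) (fun _ m => m) = 1
  classical
  rw [Finsupp.sum_add_index' (fun _ => rfl) (fun _ _ _ => rfl), key, key,
    ← Finsupp.sum_add_index' (fun _ => rfl) (fun _ _ _ => rfl), add_sub_cancel]
  exact x.sum_eq_one

/-- The point at height `t` on the prism path from the image of `x` under `f` to its image under
`g`. -/
def prism (f g : Q →o R) (hfg : f ≤ g) (t : ℝ) (x : (orderComplex Q).Realization) :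
    (orderComplex R).Realization where
  -- The total mass is `1`, so at `t = 0` everything is moved by `f` and at `t = 1` everything by
  -- `g`.
  weight := (lowerMass x.weight (1 - t)).mapDomain f +
    (x.weight - lowerMass x.weight (1 - t)).mapDomain g
  nonneg v := add_nonneg (Finsupp.mapDomain_nonneg_apply _ (lowerMass.nonneg x.nonneg) v)
    (Finsupp.mapDomain_nonneg_apply _ (fun y => sub_nonneg.2 (lowerMass.le y)) v)
  sum_eq_one := sum_prismWeight f g _ x
  support_mem := by
    classical
    refine ⟨?_, ?_⟩
    · refine Finset.nonempty_of_ne_empty fun h => ?_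
      have h1 := sum_prismWeight f g (1 - t) x
      rw [h, Finset.sum_empty] at h1
      exact zero_ne_one h1
    · set a := lowerMass x.weight (1 - t)
      have hch : IsChain (· ≤ ·) (x.weight.support : Set Q) := x.support_mem.2
      have ha : a.support ⊆ x.weight.support := lowerMass.support_subset
      have hb : (x.weight - a).support ⊆ x.weight.support := fun y hy => by
        rcases Finset.mem_union.1 (Finsupp.support_sub hy) with h | h
        exacts [h, ha h]
      have hab : ∀ {y z}, y ∈ a.support → z ∈ (x.weight - a).support → f y ≤ g z :=
        fun {y z} hy hz => (hfg y).trans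
          (g.monotone (lowerMass.le_of_mem_support x.nonneg hch hy hz))
      have hmem : ∀ v ∈ (a.mapDomain f + (x.weight - a).mapDomain g).support,
          (∃ y ∈ a.support, f y = v) ∨ ∃ z ∈ (x.weight - a).support, g z = v := fun v hv => by
        rcases Finset.mem_union.1 (Finsupp.support_add hv) with h | h
        · exact .inl (Finset.mem_image.1 (Finsupp.mapDomain_support h))
        · exact .inr (Finset.mem_image.1 (Finsupp.mapDomain_support h))
      intro u hu v hv _
      rcases hmem u hu with ⟨y, hy, rfl⟩ | ⟨y, hy, rfl⟩ <;>
        rcases hmem v hv with ⟨z, hz, rfl⟩ | ⟨z, hz, rfl⟩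
      · exact (hch.total (ha hy) (ha hz)).imp (fun h => f.monotone h) fun h => f.monotone h
      · exact .inl (hab hy hz)
      · exact .inr (hab hz hy)
      · exact (hch.total (hb hy) (hb hz)).imp (fun h => g.monotone h) fun h => g.monotone h

theorem prism_weight_zero (f g : Q →o R) (hfg : f ≤ g) (x : (orderComplex Q).Realization) :
    (prism f g hfg 0 x).weight = x.weight.mapDomain f := by
  have h : lowerMass x.weight (1 - 0) = x.weight :=
    lowerMass.eq_self x.nonneg (by rw [x.sum_eq_one, sub_zero])
  simp only [prism, h, sub_self, Finsupp.mapDomain_zero, add_zero]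

theorem prism_weight_one (f g : Q →o R) (hfg : f ≤ g) (x : (orderComplex Q).Realization) :
    (prism f g hfg 1 x).weight = x.weight.mapDomain g := by
  have h : lowerMass x.weight (1 - 1) = 0 := lowerMass.eq_zero x.nonneg (sub_self _).le
  simp only [prism, h, sub_zero, Finsupp.mapDomain_zero, zero_add]

theorem continuous_prism_of_support_subset (f g : Q →o R) (hfg : f ≤ g) {X : Type*}
    [TopologicalSpace X] {e : X → (orderComplex Q).Realization} {τ : X → ℝ} (hτ : Continuous τ)
    (s : Finset Q) (hs : ∀ x, (e x).weight.support ⊆ s)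
    (he : ∀ v, Continuous fun x => (e x).weight v) :
    Continuous fun x => prism f g hfg (τ x) (e x) := by
  classical
  have ha : ∀ x, (lowerMass (e x).weight (1 - τ x)).support ⊆ s :=
    fun x => lowerMass.support_subset.trans (hs x)
  have hb : ∀ x, ((e x).weight - lowerMass (e x).weight (1 - τ x)).support ⊆ s :=
    fun x => Finsupp.support_sub.trans (Finset.union_subset (hs x) (ha x))
  have hca : ∀ q, Continuous fun x => lowerMass (e x).weight (1 - τ x) q := fun q => by
    simp_rw [fun x => lowerMass.apply_eq (c := 1 - τ x) (hs x) q]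
    fun_prop
  refine continuous_of_support_subset (s.image f ∪ s.image g) (fun x => ?_) fun v => ?_
  · refine Finsupp.support_add.trans (Finset.union_subset_union ?_ ?_)
    · exact Finsupp.mapDomain_support.trans (Finset.image_subset_image (ha x))
    · exact Finsupp.mapDomain_support.trans (Finset.image_subset_image (hb x))
  · simp only [prism, Finsupp.add_apply, fun x => Finsupp.mapDomain_apply_of_support_subset f (ha x) v,
      fun x => Finsupp.mapDomain_apply_of_support_subset g (hb x) v, Finsupp.sub_apply]
    refine (continuous_finsetSum _ fun q _ => ?_).add (continuous_finsetSum _ fun q _ => ?_)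
    · split_ifs
      exacts [hca q, continuous_const]
    · split_ifs
      exacts [(he q).sub (hca q), continuous_const]

attribute [local irreducible] prism

theorem continuous_uncurry_prism_of_support_subset (f g : Q →o R) (hfg : f ≤ g) {X : Type*}
    [TopologicalSpace X] {e : X → (orderComplex Q).Realization}
    (s : Finset Q) (hs : ∀ x, (e x).weight.support ⊆ s)
    (he : ∀ v, Continuous fun x => (e x).weight v) :
    Continuous fun p : X × ℝ => prism f g hfg p.2 (e p.1) :=
  continuous_prism_of_support_subset f g hfg continuous_snd s
    (fun p => hs p.1) fun v => (he v).comp continuous_fst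

/-- The weak topology tests continuity on simplices only for maps out of the realization itself, not
out of its product with `ℝ`. Hence the map is curried into `C(ℝ, _)`, tested there, and uncurried by
local compactness of `ℝ`. -/
theorem continuous_prism (f g : Q →o R) (hfg : f ≤ g) :
    Continuous fun p : (orderComplex Q).Realization × ℝ => prism f g hfg p.2 p.1 := by
  let Φ : (orderComplex Q).Realization → C(ℝ, (orderComplex R).Realization) := fun x =>
    ⟨fun t => prism f g hfg t x, continuous_prism_of_support_subset f g hfg
      continuous_id x.weight.support (fun _ => subset_rfl) fun _ => continuous_const⟩
  have hΦ : Continuous Φ := continuous_dom_iff.2 fun s hs => by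
    refine @ContinuousMap.continuous_of_continuous_uncurry _ _ _ (simplexTopology _ s) _ _ _ ?_
    exact @continuous_uncurry_prism_of_support_subset _ _ _ _ f g hfg _ (simplexTopology _ s)
      (fun x => x.1) s (fun x => x.2)
      fun v => continuous_dom_iff.1 (continuous_weight v) s hs
  exact ContinuousMap.continuous_uncurry_of_continuous ⟨Φ, hΦ⟩

/-- The map of realizations induced by a monotone map. -/
def realizationMap (f : Q →o R) : C((orderComplex Q).Realization, (orderComplex R).Realization) where
  toFun x := prism f f le_rfl 0 x
  continuous_toFun := (continuous_prism f f le_rfl).comp (Continuous.prodMk_left 0)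

theorem realizationMap_weight (f : Q →o R) (x : (orderComplex Q).Realization) :
    (realizationMap f x).weight = x.weight.mapDomain f :=
  prism_weight_zero f f le_rfl x

theorem realizationMap_id :
    realizationMap (OrderHom.id : Q →o Q) = ContinuousMap.id _ := by
  ext1 x
  exact Realization.ext ((realizationMap_weight _ x).trans Finsupp.mapDomain_id)

theorem realizationMap_comp (g : R →o S) (f : Q →o R) :
    (realizationMap g).comp (realizationMap f) = realizationMap (g.comp f) := by
  ext1 x
  apply Realization.ext
  rw [ContinuousMap.comp_apply, realizationMap_weight, realizationMap_weight,
    realizationMap_weight, ← Finsupp.mapDomain_comp]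
  rfl

/-- Comparable monotone maps induce homotopic maps. -/
theorem realizationMap_homotopic {f g : Q →o R} (hfg : f ≤ g) :
    (realizationMap f).Homotopic (realizationMap g) :=
  ⟨{ toFun := fun p => prism f g hfg p.1 p.2
     continuous_toFun := (continuous_prism f g hfg).comp
      (continuous_snd.prodMk (continuous_subtype_val.comp continuous_fst))
     map_zero_left := fun x => Realization.ext
      ((prism_weight_zero f g hfg x).trans (realizationMap_weight f x).symm)
     map_one_left := fun x => Realization.ext
      ((prism_weight_one f g hfg x).trans (realizationMap_weight g x).symm) }⟩

end orderComplex

end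

theorem mainTheorem7 {P : Type*} [PartialOrder P] (r : ℕ) (hr : 1 ≤ r) :
    Nonempty (ContinuousMap.HomotopyEquiv
      (orderComplex (Multichain P r)).Realization (orderComplex P).Realization) := by
  let first : Multichain P r →o P := ⟨fun p => p ⟨0, hr⟩, fun _ _ h => h _⟩
  let diag : P →o Multichain P r := ⟨fun p => OrderHom.const _ p, fun _ _ h _ => h⟩
  -- The first entry is the least one, so its constant multichain lies below `p`.
  have hle : diag.comp first ≤ OrderHom.id := fun p i => p.monotone (Nat.zero_le i)
  have hid : first.comp diag = OrderHom.id := rfl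
  refine ⟨⟨orderComplex.realizationMap first, orderComplex.realizationMap diag, ?_, ?_⟩⟩
  · rw [orderComplex.realizationMap_comp, ← orderComplex.realizationMap_id]
    exact orderComplex.realizationMap_homotopic hle
  · rw [orderComplex.realizationMap_comp, hid, orderComplex.realizationMap_id]
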